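/- Let $\mathcal S,\mathcal A,\mathcal R$ be finite sets of states, actions and rewards, $S:=|\mathcal S|$, $A:=|\mathcal A|$, let $M\ge 1$, $d:=2M-1$, and let $H>2M$ be the horizon. A latent MDP (LMDP) model $\theta=\{(w_m,\mu_m,T_m,R_m)\}_{m=1}^M$ consists of mixing weights $w_m\ge 0$ with $\sum_m w_m=1$ and, for every context $m\in[M]$, an initial state distribution $\mu_m$ on $\mathcal S$, transition probabilities $T_m(\cdot\mid s,a)$ on $\mathcal S$ and reward probabilities $R_m(\cdot\mid s,a)$ on $\mathcal R$. A (history-dependent) policy $\pi\in\Pi$ consists of a probability space $(\Xi,\rho)$ and action distributions $\pi_t(\cdot\mid \xi,(s_i,a_i,r_i)_{i<t},s_t)$ on $\mathcal A$, $t\in[H]$, measurable in $\xi\in\Xi$, where the seed $\xi\sim\rho$ is drawn at the beginning of the episode independently of the context, the states and the rewards. A memoryless policy $\psi\in\Pi_{\mathrm{mls}}$ consists of action distributions $\psi_t(\cdot\mid s_t)$ that depend only on $t\in[H]$ and $s_t\in\mathcal S$. Let $\mathbb P_\theta^\pi$ be the distribution of the trajectory $\mathcal T=(s_t,a_t,r_t)_{t=1}^H$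 when $\pi$ is executed in $\theta$, with the context $m$ not observed: $$\mathbb P_\theta^\pi(\mathcal T)=\sum_{m=1}^M w_m\int_\Xi \prod_{t=1}^H P_{m,t}(s_t)\,\pi_t\big(a_t\mid\xi,(s_i,a_i,r_i)_{i<t},s_t\big)\,R_m(r_t\mid s_t,a_t)\,d\rho(\xi),$$ where $P_{m,1}(s_1)=\mu_m(s_1)$ and $P_{m,t}(s_t)=T_m(s_t\mid s_{t-1},a_{t-1})$ for $t\ge 2$. Let $\mathrm{TV}$ denote the total variation distance. Let $\theta_1,\theta_2$ be two LMDP models with the same $\mathcal S,\mathcal A,\mathcal R,M$, let $\epsilon_{\mathrm{test}}\in\mathbb R$, and suppose that $$\mathrm{TV}\big(\mathbb P_{\theta_1}^{\psi},\mathbb P_{\theta_2}^{\psi}\big)\le\epsilon_{\mathrm{test}}\qquad\text{for every memoryless policy }\psi\in\Pi_{\mathrm{mls}}.$$ Then for every history-dependent policy $\pi\in\Pi$, $$\mathrm{TV}\big(\mathbb P_{\theta_1}^{\pi},\mathbb P_{\theta_2}^{\pi}\big)\le M\,(2H^2)^d\,(MSA)^d\,\epsilon_{\mathrm{test}}.$$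 -/

import Mathlib

open MeasureTheory

/-- A latent Markov decision process with `M` latent contexts, on states `S`, actions `A` and
rewards `R`. Context `m` is drawn with probability `weight m` at the start of an episode and stays
fixed; the episode then follows the time-homogeneous MDP with initial state distribution `init m`,
transition kernel `trans m` and reward kernel `reward m`.
The elements of `stdSimplex ℝ X` are the probability vectors on the finite type `X`. -/
structure LMDP (S A R : Type*) [Fintype S] [Fintype R] (M : ℕ) where
  weight : stdSimplex ℝ (Fin M)
  init : Fin M → stdSimplex ℝ S
  trans : Fin M → S → A → stdSimplex ℝ S
  reward : Fin M → S → A → stdSimplex ℝ R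

/-- Trajectories `(s_t, a_t, r_t)` of horizon `H`. Time steps are numbered `0, …, H - 1`. -/
abbrev Trajectory (S A R : Type*) (H : ℕ) := Fin H → S × A × R

namespace Trajectory

variable {S A R : Type*} {H : ℕ}

/-- The state at time `t`. -/
def state (T : Trajectory S A R H) (t : Fin H) : S := (T t).1

/-- The action at time `t`. -/
def action (T : Trajectory S A R H) (t : Fin H) : A := (T t).2.1

/-- The reward at time `t`. -/
def rew (T : Trajectory S A R H) (t : Fin H) : R := (T t).2.2

/-- The triples `(s, a, r)` at the time steps strictly before `t`. -/
def past (T : Trajectory S A R H) (t : Fin H) : Fin (t : ℕ) → S × A × R :=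
  fun i => T ⟨i, i.isLt.trans t.isLt⟩

end Trajectory

/-- A history-dependent policy. A seed in `Ξ` is drawn from `seed` at the beginning of the episode,
independently of everything else; at time `t`, the action is drawn from a distribution that
depends on the seed, on the triples `(s, a, r)` before time `t` and on the current state. -/
structure Policy (Ξ S A R : Type*) [MeasurableSpace Ξ] [Fintype A] (H : ℕ) where
  seed : ProbabilityMeasure Ξ
  act : Ξ → (t : Fin H) → (Fin (t : ℕ) → S × A × R) → S → stdSimplex ℝ A
  measurable_act : ∀ (t : Fin H) (h : Fin (t : ℕ) → S × A × R) (s : S) (a : A),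
    Measurable fun ξ => act ξ t h s a

/-- A memoryless policy: the action distribution depends only on the time and the current state. -/
def MemorylessPolicy (S A : Type*) [Fintype A] (H : ℕ) := Fin H → S → stdSimplex ℝ A

/-- A memoryless policy as a history-dependent policy (with a trivial seed). -/
noncomputable def MemorylessPolicy.toPolicy {S A : Type*} [Fintype A] {H : ℕ}
    (ψ : MemorylessPolicy S A H) (R : Type*) : Policy Unit S A R H where
  seed := ⟨Measure.dirac (), inferInstance⟩
  act _ t _ s := ψ t s
  measurable_act _ _ _ _ := measurable_const

namespace LMDP

variable {Ξ S A R : Type*} [MeasurableSpace Ξ] [Fintype S] [Fintype A] [Fintype R] {M H : ℕ}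

/-- The conditional probability, in context `m`, of the state of `T` at time `t` given what
precedes it in `T`: the initial distribution at the first step, the transition kernel later. -/
def stateProb (θ : LMDP S A R M) (m : Fin M) (T : Trajectory S A R H) : Fin H → ℝ
  | ⟨0, h⟩ => θ.init m (T.state ⟨0, h⟩)
  | ⟨t + 1, h⟩ =>
      θ.trans m (T.state ⟨t, (Nat.lt_succ_self t).trans h⟩)
        (T.action ⟨t, (Nat.lt_succ_self t).trans h⟩) (T.state ⟨t + 1, h⟩)

/-- The probability mass function of the trajectory when policy `π` is executed in `θ`. -/
noncomputable def trajProb (θ : LMDP S A R M) (π : Policy Ξ S A R H)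
    (T : Trajectory S A R H) : ℝ :=
  ∑ m : Fin M, θ.weight m *
    ∫ ξ, ∏ t : Fin H,
      (θ.stateProb m T t *
        π.act ξ t (T.past t) (T.state t) (T.action t) *
        θ.reward m (T.state t) (T.action t) (T.rew t)) ∂(π.seed : Measure Ξ)

end LMDP

/-- Total variation distance between two probability mass functions on a finite type. -/
noncomputable def tvDist {X : Type*} [Fintype X] (p q : X → ℝ) : ℝ :=
  (1 / 2) * ∑ x, |p x - q x|

section Values

variable {S A R K : Type*} [Fintype S] [Fintype R]

/-- The sum of `Φ s v` over all paths of `n` steps along the deterministic memoryless policy `ψ`,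
where `s` is the state reached and `v` the vector of the likelihoods of the path in the contexts
`K`. The path starts in `s` with likelihoods `μ s`; a step from `s` with action `a` at time `n` that
yields the reward and next state `o` multiplies the likelihoods by `q n s a o`. -/
def mlsValue (μ : S → K → ℝ) (q : ℕ → S → A → R × S → K → ℝ) (ψ : ℕ → S → A) :
    ℕ → (S → (K → ℝ) → ℝ) → ℝ
  | 0, Φ => ∑ s, Φ s (μ s)
  | n + 1, Φ => mlsValue μ q ψ n fun s v => ∑ o, Φ o.2 (v * q n s (ψ n s) o)

/-- The largest value of the sum of `Φ s v` over all paths of `n` steps that a policy can achieve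
when it observes the likelihoods. -/
noncomputable def optValue [Fintype A] [Nonempty A] (μ : S → K → ℝ) (q : ℕ → S → A → R × S → K → ℝ) :
    ℕ → (S → (K → ℝ) → ℝ) → ℝ
  | 0, Φ => ∑ s, Φ s (μ s)
  | n + 1, Φ => optValue μ q n fun s v =>
      Finset.univ.sup' Finset.univ_nonempty fun a => ∑ o, Φ o.2 (v * q n s a o)

variable {μ : S → K → ℝ} {q : ℕ → S → A → R × S → K → ℝ} {ψ : ℕ → S → A}

theorem mlsValue_mono (n : ℕ) {Φ Φ' : S → (K → ℝ) → ℝ} (h : ∀ s v, Φ s v ≤ Φ' s v) :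
    mlsValue μ q ψ n Φ ≤ mlsValue μ q ψ n Φ' := by
  induction n generalizing Φ Φ' with
  | zero => exact Finset.sum_le_sum fun s _ => h s _
  | succ n ih => exact ih fun s v => Finset.sum_le_sum fun o _ => h _ _

theorem mlsValue_add (n : ℕ) (Φ Φ' : S → (K → ℝ) → ℝ) :
    mlsValue μ q ψ n (fun s v => Φ s v + Φ' s v) =
      mlsValue μ q ψ n Φ + mlsValue μ q ψ n Φ' := by
  induction n generalizing Φ Φ' with
  | zero => exact Finset.sum_add_distrib
  | succ n ih => simp only [mlsValue, Finset.sum_add_distrib, ih]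

theorem mlsValue_nonneg (n : ℕ) {Φ : S → (K → ℝ) → ℝ} (h : ∀ s v, 0 ≤ Φ s v) :
    0 ≤ mlsValue μ q ψ n Φ := by
  induction n generalizing Φ with
  | zero => exact Finset.sum_nonneg fun s _ => h s _
  | succ n ih => exact ih fun s v => Finset.sum_nonneg fun o _ => h _ _

theorem mlsValue_congr {ψ' : ℕ → S → A} (n : ℕ) (h : ∀ i < n, ψ i = ψ' i)
    (Φ : S → (K → ℝ) → ℝ) : mlsValue μ q ψ n Φ = mlsValue μ q ψ' n Φ := by
  induction n generalizing Φ with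
  | zero => rfl
  | succ n ih =>
    simp only [mlsValue, h n n.lt_succ_self]
    exact ih (fun i hi => h i (hi.trans n.lt_succ_self)) _

theorem seminorm_sum_le {ι E : Type*} [AddCommGroup E] [Module ℝ E] (p : Seminorm ℝ E)
    (I : Finset ι) (x : ι → E) : p (∑ i ∈ I, x i) ≤ ∑ i ∈ I, p (x i) :=
  Finset.le_sum_of_subadditive p (map_zero p).le (map_add_le_add p) I x

/-- A memoryless policy that switches at time `j` to one with value functions `ρ` collects at least
the seminorm of the predicted values. -/
theorem mlsValue_predicted_le {t : ℕ} {f : S → ℝ} {φ : ℕ → S → A} {ρ : ℕ → S → K → ℝ}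
    (p : Seminorm ℝ (K → ℝ)) (hf : ∀ s, 0 ≤ f s) (h0 : ∀ s, ρ t s = fun _ => f s)
    (hrec : ∀ j < t, ∀ s, ρ j s = ∑ o, q j s (φ j s) o * ρ (j + 1) o.2)
    {E : ℝ} (hE : ∀ ψ : ℕ → S → A, mlsValue μ q ψ t (fun s v => f s * p v) ≤ E)
    {j : ℕ} (hj : j ≤ t) (ψ : ℕ → S → A) :
    mlsValue μ q ψ j (fun s v => p (v * ρ j s)) ≤ E := by
  induction hj using Nat.decreasingInduction generalizing ψ with
  | self =>
    refine le_trans (mlsValue_mono t fun s v => ?_) (hE ψ)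
    have : v * ρ t s = f s • v := by
      rw [h0]; ext k; simp [mul_comm]
    rw [this, map_smul_eq_mul, Real.norm_of_nonneg (hf s)]
  | of_succ j hj ih =>
    let ψ' : ℕ → S → A := fun i => if i < j then ψ i else φ i
    refine le_trans ?_ (ih ψ')
    rw [mlsValue_congr (ψ' := ψ') j (fun i hi => by simp [ψ', hi])]
    refine mlsValue_mono j fun s v => ?_
    rw [hrec j hj, Finset.mul_sum]
    refine (seminorm_sum_le _ _ _).trans (le_of_eq ?_)
    simp [ψ', mul_assoc]

variable [Fintype A] [Nonempty A]

theorem optValue_mono (n : ℕ) {Φ Φ' : S → (K → ℝ) → ℝ} (h : ∀ s v, Φ s v ≤ Φ' s v) :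
    optValue μ q n Φ ≤ optValue μ q n Φ' := by
  induction n generalizing Φ Φ' with
  | zero => exact Finset.sum_le_sum fun s _ => h s _
  | succ n ih =>
    exact ih fun s v => Finset.sup'_mono_fun fun a _ => Finset.sum_le_sum fun o _ => h _ _

theorem optValue_add_le (n : ℕ) (Φ Φ' : S → (K → ℝ) → ℝ) :
    optValue μ q n (fun s v => Φ s v + Φ' s v) ≤ optValue μ q n Φ + optValue μ q n Φ' := by
  induction n generalizing Φ Φ' with
  | zero => exact Finset.sum_add_distrib.le
  | succ n ih =>
    refine le_trans (optValue_mono n fun s v => ?_) (ih _ _)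
    refine Finset.sup'_le _ _ fun a _ => ?_
    rw [Finset.sum_add_distrib]
    exact add_le_add
      (Finset.le_sup' (fun a => ∑ o, Φ o.2 (v * q n s a o)) (Finset.mem_univ a))
      (Finset.le_sup' (fun a => ∑ o, Φ' o.2 (v * q n s a o)) (Finset.mem_univ a))

theorem optValue_zero (n : ℕ) : optValue μ q n (fun _ _ => 0) = 0 := by
  induction n with
  | zero => simp [optValue]
  | succ n ih => simpa [optValue] using ih

theorem optValue_sum_le {ι : Type*} (I : Finset ι) (n : ℕ) (Φ : ι → S → (K → ℝ) → ℝ) :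
    optValue μ q n (fun s v => ∑ i ∈ I, Φ i s v) ≤ ∑ i ∈ I, optValue μ q n (Φ i) := by
  classical
  induction I using Finset.induction_on with
  | empty => simp [optValue_zero]
  | insert i I hi ih =>
    simp only [Finset.sum_insert hi]
    exact (optValue_add_le n _ _).trans (by gcongr)

/-- Backward induction: a memoryless policy that is optimal, in the context `N`, for collecting
`f` at time `t`, together with its value functions in all contexts. -/
theorem exists_optimal_policy (t : ℕ) (q : ℕ → S → A → R × S → K → ℝ)
    (hq : ∀ n s a o k, 0 ≤ q n s a o k) (f : S → ℝ) (hf : ∀ s, 0 ≤ f s) (N : K) :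
    ∃ (φ : ℕ → S → A) (ρ : ℕ → S → K → ℝ), (∀ s, ρ t s = fun _ => f s) ∧
      (∀ j s, 0 ≤ ρ j s N) ∧
      (∀ j < t, ∀ s, ρ j s = ∑ o, q j s (φ j s) o * ρ (j + 1) o.2) ∧
      ∀ j < t, ∀ s a, ∑ o, q j s a o N * ρ (j + 1) o.2 N ≤ ρ j s N := by
  induction t generalizing q with
  | zero =>
    exact ⟨fun _ _ => Classical.arbitrary A, fun _ s _ => f s, fun _ => rfl, fun _ s => hf s,
      by simp, by simp⟩
  | succ t ih =>
    obtain ⟨φ, ρ, h0, hpos, hrec, hopt⟩ := ih (fun n => q (n + 1)) fun n => hq (n + 1)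
    choose b hb using fun s => Finite.exists_max fun a => ∑ o, q 0 s a o N * ρ 0 o.2 N
    refine ⟨fun j => j.casesOn b φ, fun j => j.casesOn (fun s => ∑ o, q 0 s (b s) o * ρ 0 o.2) ρ,
      h0, ?_, ?_, ?_⟩
    · rintro (_ | j) s
      · change 0 ≤ (∑ o, q 0 s (b s) o * ρ 0 o.2) N
        rw [Finset.sum_apply]
        exact Finset.sum_nonneg fun o _ => mul_nonneg (hq _ _ _ _ _) (hpos _ _)
      · exact hpos j s
    · rintro (_ | j) hj s
      · rfl
      · exact hrec j (by omega) s
    · rintro (_ | j) hj s a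
      · change _ ≤ (∑ o, q 0 s (b s) o * ρ 0 o.2) N
        rw [Finset.sum_apply]
        exact hb s a
      · exact hopt j (by omega) s a

/-- The bound `∑ i < n, x ^ i` in recursive form. -/
def geomBound (x : ℝ) : ℕ → ℝ
  | 0 => 0
  | n + 1 => 1 + x * geomBound x n

theorem geomBound_nonneg {x : ℝ} (hx : 0 ≤ x) (n : ℕ) : 0 ≤ geomBound x n := by
  induction n with
  | zero => exact le_rfl
  | succ n ih => unfold geomBound; positivity

theorem geomBound_succ_le {x : ℝ} (hx : 0 ≤ x) (n : ℕ) : geomBound x (n + 1) ≤ (1 + x) ^ n := by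
  induction n with
  | zero => simp [geomBound]
  | succ n ih =>
    rw [geomBound, pow_succ]
    have : 1 ≤ (1 + x) ^ n := one_le_pow₀ (by linarith)
    nlinarith [mul_le_mul_of_nonneg_left ih hx]

/-- Policies that observe the likelihoods are not much better than deterministic memoryless ones at
collecting a seminorm of the likelihoods that only depends on few contexts. -/
theorem optValue_le_of_mlsValue_le (hq : ∀ n s a o k, 0 ≤ q n s a o k) (H n : ℕ)
    (C : Finset K) (hC : C.card = n) (p : Seminorm ℝ (K → ℝ))
    (hp : ∀ v, (∀ k ∈ C, v k = 0) → p v = 0) (t : ℕ) (ht : t ≤ H) (f : S → ℝ) (hf : ∀ s, 0 ≤ f s)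
    (E : ℝ) (hE : ∀ ψ : ℕ → S → A, mlsValue μ q ψ t (fun s v => f s * p v) ≤ E) :
    optValue μ q t (fun s v => f s * p v) ≤
      geomBound (2 * H * Fintype.card S * Fintype.card A) n * E := by
  classical
  induction n generalizing C p t f E with
  | zero =>
    have : C = ∅ := Finset.card_eq_zero.1 hC
    subst this
    have h0 : ∀ v, p v = 0 := fun v => hp v (by simp)
    simp [h0, optValue_zero, geomBound]
  | succ n ih =>
    have hE0 : 0 ≤ E := (mlsValue_nonneg t fun s v => mul_nonneg (hf s) (apply_nonneg p v)).trans
      (hE fun _ _ => Classical.arbitrary A)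
    obtain ⟨N, hN⟩ : C.Nonempty := Finset.card_pos.1 (by omega)
    obtain ⟨φ, ρ, h0, hpos, hrec, hopt⟩ := exists_optimal_policy t q hq f hf N
    have hpred : ∀ j ≤ t, ∀ ψ : ℕ → S → A, mlsValue μ q ψ j (fun s v => p (v * ρ j s)) ≤ E :=
      fun j hj ψ => mlsValue_predicted_le p hf h0 hrec hE hj ψ
    let z : ℕ → S → A → R × S → ℝ := fun j s a o => q j s a o N * ρ (j + 1) o.2 N / ρ j s N
    have hz0 : ∀ j s a o, 0 ≤ z j s a o := fun j s a o =>
      div_nonneg (mul_nonneg (hq _ _ _ _ _) (hpos _ _)) (hpos _ _)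
    have hz1 : ∀ j < t, ∀ s a, ∑ o, z j s a o ≤ 1 := fun j hj s a => by
      simp only [z, ← Finset.sum_div]
      exact div_le_one_of_le₀ (hopt j hj s a) (hpos _ _)
    let Δ : ℕ → S → A → R × S → K → ℝ := fun j s a o =>
      q j s a o * ρ (j + 1) o.2 - z j s a o • ρ j s
    have hΔN : ∀ j < t, ∀ s a o, Δ j s a o N = 0 := fun j hj s a o => by
      have hnn : ∀ o, 0 ≤ q j s a o N * ρ (j + 1) o.2 N := fun o =>
        mul_nonneg (hq _ _ _ _ _) (hpos _ _)
      simp only [Δ, z, Pi.sub_apply, Pi.mul_apply, Pi.smul_apply, smul_eq_mul]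
      by_cases h : ρ j s N = 0
      · have hle := Finset.single_le_sum (fun o _ => hnn o) (Finset.mem_univ o)
        have := hle.trans (hopt j hj s a)
        rw [h] at this ⊢
        linarith [le_antisymm this (hnn o)]
      · rw [div_mul_cancel₀ _ h, sub_self]
    let p' : ℕ → S → A → Seminorm ℝ (K → ℝ) := fun j s a =>
      ∑ o, p.comp (LinearMap.mulRight ℝ (Δ j s a o))
    have hp' : ∀ j s a v, p' j s a v = ∑ o, p (v * Δ j s a o) := fun j s a v => by
      simp only [p', ← FunLike.coeAddMonoidHom_apply, map_sum, Finset.sum_apply]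
      rfl
    have htest : ∀ j < t, ∀ s₀ a₀ (ψ : ℕ → S → A),
        mlsValue μ q ψ j (fun s v => (if s = s₀ then 1 else 0) * p' j s₀ a₀ v) ≤ 2 * E := by
      intro j hj s₀ a₀ ψ
      let ψ' : ℕ → S → A := fun i s => if i = j then a₀ else ψ i s
      have h1 := hpred (j + 1) hj ψ'
      have h2 := hpred j hj.le ψ'
      rw [mlsValue_congr (ψ' := ψ') j
        (fun i hi => by funext s; simp [ψ', hi.ne]), two_mul]
      refine le_trans ?_ (add_le_add h1 h2)
      rw [mlsValue, ← mlsValue_add]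
      refine mlsValue_mono j fun s v => ?_
      split_ifs with hs
      · subst hs
        rw [one_mul, hp']
        calc ∑ o, p (v * Δ j s a₀ o)
            ≤ ∑ o, (p (v * q j s a₀ o * ρ (j + 1) o.2) + z j s a₀ o * p (v * ρ j s)) := by
              refine Finset.sum_le_sum fun o _ => ?_
              have : v * Δ j s a₀ o =
                  v * q j s a₀ o * ρ (j + 1) o.2 - z j s a₀ o • (v * ρ j s) := by
                simp only [Δ, mul_sub, mul_assoc, mul_smul_comm]
              rw [this]
              refine (map_sub_le_add p _ _).trans ?_
              rw [map_smul_eq_mul, Real.norm_of_nonneg (hz0 _ _ _ _)]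
          _ ≤ _ := by
              rw [Finset.sum_add_distrib, ← Finset.sum_mul]
              simp only [ψ', if_true]
              gcongr
              exact mul_le_of_le_one_left (apply_nonneg p _) (hz1 j hj s a₀)
      · rw [zero_mul]
        exact add_nonneg (Finset.sum_nonneg fun o _ => apply_nonneg p _) (apply_nonneg p _)
    set x : ℝ := 2 * H * Fintype.card S * Fintype.card A with hx
    have hG : 0 ≤ geomBound x n := geomBound_nonneg (by positivity) n
    have helim : ∀ j < t, ∀ s₀ a₀,
        optValue μ q j (fun s v => (if s = s₀ then 1 else 0) * p' j s₀ a₀ v) ≤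
          geomBound x n * (2 * E) := by
      intro j hj s₀ a₀
      refine ih (C.erase N) (by rw [Finset.card_erase_of_mem hN]; omega) _ ?_ j (by omega) _
        (fun s => by split_ifs <;> norm_num) _ (htest j hj s₀ a₀)
      intro v hv
      rw [hp']
      refine Finset.sum_eq_zero fun o _ => hp _ fun k hk => ?_
      by_cases hkN : k = N
      · subst hkN; simp [hΔN j hj]
      · simp [hv k (Finset.mem_erase.2 ⟨hkN, hk⟩)]
    have hstep : ∀ j < t, ∀ s v a, ∑ o, p (v * q j s a o * ρ (j + 1) o.2) ≤
        p (v * ρ j s) + ∑ i : S × A, (if s = i.1 then 1 else 0) * p' j i.1 i.2 v := by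
      intro j hj s v a
      calc ∑ o, p (v * q j s a o * ρ (j + 1) o.2)
          ≤ ∑ o, (z j s a o * p (v * ρ j s) + p (v * Δ j s a o)) := by
            refine Finset.sum_le_sum fun o _ => ?_
            have : v * q j s a o * ρ (j + 1) o.2 =
                z j s a o • (v * ρ j s) + v * Δ j s a o := by
              simp only [Δ, mul_sub, mul_assoc, mul_smul_comm, add_sub_cancel]
            rw [this]
            refine (map_add_le_add p _ _).trans ?_
            rw [map_smul_eq_mul, Real.norm_of_nonneg (hz0 _ _ _ _)]
        _ ≤ p (v * ρ j s) + p' j s a v := by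
            rw [Finset.sum_add_distrib, ← Finset.sum_mul, hp']
            gcongr
            exact mul_le_of_le_one_left (apply_nonneg p _) (hz1 j hj s a)
        _ ≤ _ := by
            gcongr
            have := Finset.single_le_sum (f := fun i : S × A =>
              (if s = i.1 then (1 : ℝ) else 0) * p' j i.1 i.2 v)
              (fun i _ => mul_nonneg (by split_ifs <;> norm_num) (apply_nonneg _ _))
              (Finset.mem_univ (s, a))
            simpa using this
    have hmain : ∀ j ≤ t, optValue μ q j (fun s v => p (v * ρ j s)) ≤
        E + j * (Fintype.card S * Fintype.card A * (geomBound x n * (2 * E))) := by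
      intro j
      induction j with
      | zero => intro hj; simpa [optValue, mlsValue] using hpred 0 hj fun _ _ => Classical.arbitrary A
      | succ j ihj =>
        intro hj
        calc optValue μ q (j + 1) (fun s v => p (v * ρ (j + 1) s))
            ≤ optValue μ q j (fun s v => p (v * ρ j s) +
                ∑ i : S × A, (if s = i.1 then 1 else 0) * p' j i.1 i.2 v) :=
              optValue_mono j fun s v => Finset.sup'_le _ _ fun a _ => hstep j hj s v a
          _ ≤ optValue μ q j (fun s v => p (v * ρ j s)) + ∑ i : S × A, optValue μ q j
                (fun s v => (if s = i.1 then 1 else 0) * p' j i.1 i.2 v) :=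
              (optValue_add_le j _ _).trans (by gcongr; exact optValue_sum_le _ _ _)
          _ ≤ (E + j * (Fintype.card S * Fintype.card A * (geomBound x n * (2 * E)))) +
                ∑ i : S × A, geomBound x n * (2 * E) :=
              add_le_add (ihj (by omega)) (Finset.sum_le_sum fun i _ => helim j hj i.1 i.2)
          _ = _ := by
              simp only [Finset.sum_const, Finset.card_univ, Fintype.card_prod, nsmul_eq_mul]
              push_cast
              ring
    calc optValue μ q t (fun s v => f s * p v)
        = optValue μ q t (fun s v => p (v * ρ t s)) := by
          congr 1; funext s v
          have : v * ρ t s = f s • v := by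
            rw [h0]; ext k; simp [mul_comm]
          rw [this, map_smul_eq_mul, Real.norm_of_nonneg (hf s)]
      _ ≤ E + t * (Fintype.card S * Fintype.card A * (geomBound x n * (2 * E))) := hmain t le_rfl
      _ ≤ E + H * (Fintype.card S * Fintype.card A * (geomBound x n * (2 * E))) := by gcongr
      _ = geomBound x (n + 1) * E := by rw [geomBound, hx]; ring

end Values

section Paths

variable {S A R K : Type*}

/-- The product of the probabilities that the policy `pol` gives to the actions of `T`. -/
def actionProb (pol : (n : ℕ) → (Fin n → S × A × R) → S → A → ℝ) {n : ℕ}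
    (T : Trajectory S A R n) : ℝ :=
  ∏ t : Fin n, pol t (T.past t) (T.state t) (T.action t)

theorem actionProb_snoc (pol : (n : ℕ) → (Fin n → S × A × R) → S → A → ℝ) {n : ℕ}
    (T : Trajectory S A R n) (x : S × A × R) :
    actionProb pol (n := n + 1) (Fin.snoc T x) = actionProb pol T * pol n T x.1 x.2.1 := by
  have hcast : ∀ t : Fin n, (Fin.snoc T x : Fin (n + 1) → S × A × R) t.castSucc = T t :=
    fun t => Fin.snoc_castSucc (α := fun _ => S × A × R) x T t
  have hlast : (Fin.snoc T x : Fin (n + 1) → S × A × R) (Fin.last n) = x :=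
    Fin.snoc_last (α := fun _ => S × A × R) x T
  have hpast : ∀ t : Fin n, Trajectory.past (H := n + 1) (Fin.snoc T x) t.castSucc =
      Trajectory.past T t := fun t => funext fun i => hcast ⟨i, i.isLt.trans t.isLt⟩
  have hpast' : Trajectory.past (H := n + 1) (Fin.snoc T x) (Fin.last n) = T :=
    funext fun i => hcast i
  simp only [actionProb, Fin.prod_univ_castSucc, Trajectory.state, Trajectory.action, hcast,
    hlast]
  congr 1
  · exact Finset.prod_congr rfl fun t _ => by rw [← hpast t]; rfl
  · conv_rhs => rw [← hpast']
    rfl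

theorem actionProb_nonneg {pol : (n : ℕ) → (Fin n → S × A × R) → S → A → ℝ}
    (h : ∀ n T s a, 0 ≤ pol n T s a) {n : ℕ} (T : Trajectory S A R n) : 0 ≤ actionProb pol T :=
  Finset.prod_nonneg fun _ _ => h _ _ _ _

/-- The likelihoods in the contexts `K` of the path `T` followed by the state `s`. -/
def pathLikelihood (μ : S → K → ℝ) (q : ℕ → S → A → R × S → K → ℝ) :
    (n : ℕ) → (Fin n → S × A × R) → S → K → ℝ
  | 0, _, s => μ s
  | n + 1, T, s => pathLikelihood μ q n (Fin.init T) (T (Fin.last n)).1 *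
      q n (T (Fin.last n)).1 (T (Fin.last n)).2.1 ((T (Fin.last n)).2.2, s)

theorem sum_snoc {X : Type*} [Fintype X] {n : ℕ} (F : (Fin (n + 1) → X) → ℝ) :
    ∑ T, F T = ∑ T : Fin n → X, ∑ x, F (Fin.snoc T x) := by
  rw [← (Fin.snocEquiv fun _ => X).sum_comp, Fintype.sum_prod_type, Finset.sum_comm]
  rfl

variable [Fintype S] [Fintype A] [Fintype R]

/-- The sum of `Φ` over all paths of `n` steps followed by a state, under the policy `pol`. -/
def pathSum (μ : S → K → ℝ) (q : ℕ → S → A → R × S → K → ℝ)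
    (pol : (n : ℕ) → (Fin n → S × A × R) → S → A → ℝ) (n : ℕ) (Φ : S → (K → ℝ) → ℝ) : ℝ :=
  ∑ T : Trajectory S A R n, ∑ s, actionProb pol T * Φ s (pathLikelihood μ q n T s)

variable {μ : S → K → ℝ} {q : ℕ → S → A → R × S → K → ℝ}
  {pol : (n : ℕ) → (Fin n → S × A × R) → S → A → ℝ}

theorem pathSum_zero (Φ : S → (K → ℝ) → ℝ) : pathSum μ q pol 0 Φ = ∑ s, Φ s (μ s) := by
  simp [pathSum, actionProb, pathLikelihood]

theorem pathSum_succ (n : ℕ) (Φ : S → (K → ℝ) → ℝ) :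
    pathSum μ q pol (n + 1) Φ = ∑ T : Trajectory S A R n, ∑ s, actionProb pol T *
      ∑ a, pol n T s a * ∑ o : R × S, Φ o.2 (pathLikelihood μ q n T s * q n s a o) := by
  rw [pathSum, sum_snoc]
  refine Finset.sum_congr rfl fun T _ => ?_
  rw [Fintype.sum_prod_type]
  refine Finset.sum_congr rfl fun s _ => ?_
  rw [Fintype.sum_prod_type, Finset.mul_sum]
  refine Finset.sum_congr rfl fun a _ => ?_
  rw [Fintype.sum_prod_type, Finset.mul_sum, Finset.mul_sum]
  refine Finset.sum_congr rfl fun r _ => ?_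
  rw [Finset.mul_sum, Finset.mul_sum]
  refine Finset.sum_congr rfl fun s' _ => ?_
  rw [actionProb_snoc, pathLikelihood, mul_assoc]
  simp only [Fin.init_snoc, Fin.snoc_last]

theorem pathSum_le_optValue [Nonempty A] (h0 : ∀ n T s a, 0 ≤ pol n T s a)
    (h1 : ∀ n T s, ∑ a, pol n T s a ≤ 1) (n : ℕ) {Φ : S → (K → ℝ) → ℝ} (hΦ : ∀ s v, 0 ≤ Φ s v) :
    pathSum μ q pol n Φ ≤ optValue μ q n Φ := by
  induction n generalizing Φ with
  | zero => exact (pathSum_zero Φ).le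
  | succ n ih =>
    have hle : ∀ s v a, ∑ o : R × S, Φ o.2 (v * q n s a o) ≤
        Finset.univ.sup' Finset.univ_nonempty fun a => ∑ o, Φ o.2 (v * q n s a o) :=
      fun s v a => Finset.le_sup' (fun a => ∑ o, Φ o.2 (v * q n s a o)) (Finset.mem_univ a)
    have hnn : ∀ s v, 0 ≤ Finset.univ.sup' Finset.univ_nonempty fun a =>
        ∑ o : R × S, Φ o.2 (v * q n s a o) := fun s v =>
      (Finset.sum_nonneg fun o _ => hΦ _ _).trans (hle s v (Classical.arbitrary A))
    rw [pathSum_succ]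
    refine le_trans ?_ (ih hnn)
    refine Finset.sum_le_sum fun T _ => Finset.sum_le_sum fun s _ =>
      mul_le_mul_of_nonneg_left ?_ (actionProb_nonneg h0 T)
    refine (Finset.sum_le_sum fun a _ => mul_le_mul_of_nonneg_left (hle s _ a) (h0 n T s a)).trans ?_
    rw [← Finset.sum_mul]
    exact mul_le_of_le_one_left (hnn _ _) (h1 n T s)

theorem pathSum_deterministic [DecidableEq A] (ψ : ℕ → S → A) (n : ℕ) (Φ : S → (K → ℝ) → ℝ) :
    pathSum μ q (fun n _ s => Pi.single (ψ n s) 1) n Φ = mlsValue μ q ψ n Φ := by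
  induction n generalizing Φ with
  | zero => exact pathSum_zero Φ
  | succ n ih =>
    rw [pathSum_succ, mlsValue, ← ih]
    simp [pathSum, Pi.single_apply]

end Paths

namespace LMDP

variable {Ξ S A R : Type*} [MeasurableSpace Ξ] [Fintype S] [Fintype R] {M H : ℕ}

/-- The factor of the probability of `T` in context `m` that does not depend on the policy. -/
def envProb (θ : LMDP S A R M) (m : Fin M) (T : Trajectory S A R H) : ℝ :=
  ∏ t : Fin H, (θ.stateProb m T t * θ.reward m (T.state t) (T.action t) (T.rew t))

/-- The initial distributions of two models in all their contexts. -/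
def initKernel (θ : Bool → LMDP S A R M) (s : S) (k : Bool × Fin M) : ℝ := (θ k.1).init k.2 s

open Classical in
/-- The probabilities of the reward and the next state at time `n` in all contexts of two models;
at the last time step, the state does not change. -/
noncomputable def stepKernel (θ : Bool → LMDP S A R M) (H n : ℕ) (s : S) (a : A) (o : R × S)
    (k : Bool × Fin M) : ℝ :=
  (θ k.1).reward k.2 s a o.1 *
    if n + 1 < H then (θ k.1).trans k.2 s a o.2 else if o.2 = s then 1 else 0

theorem stepKernel_nonneg (θ : Bool → LMDP S A R M) (H n : ℕ) (s : S) (a : A) (o : R × S)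
    (k : Bool × Fin M) : 0 ≤ stepKernel θ H n s a o k := by
  unfold stepKernel
  refine mul_nonneg (((θ k.1).reward k.2 s a).2.1 _) ?_
  split_ifs
  · exact ((θ k.1).trans k.2 s a).2.1 _
  · exact zero_le_one
  · exact le_rfl

theorem stateProb_castSucc (θ : LMDP S A R M) (m : Fin M) (T : Trajectory S A R (H + 1))
    (t : Fin H) : θ.stateProb m T t.castSucc = θ.stateProb m (H := H) (Fin.init T) t := by
  obtain ⟨_ | t, ht⟩ := t <;> rfl

theorem pathLikelihood_mul_reward (θ : Bool → LMDP S A R M) (k : Bool × Fin M) (n : ℕ)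
    (hn : n < H) (T : Trajectory S A R (n + 1)) :
    pathLikelihood (initKernel θ) (stepKernel θ H) n (Fin.init T) (T (Fin.last n)).1 k *
      (θ k.1).reward k.2 (T.state (Fin.last n)) (T.action (Fin.last n)) (T.rew (Fin.last n)) =
      (θ k.1).envProb k.2 T := by
  induction n with
  | zero => simp [envProb, pathLikelihood, initKernel, stateProb, Trajectory.state]
  | succ n ih =>
    have h := ih (by omega) (Fin.init T)
    rw [envProb, Fin.prod_univ_castSucc, ← mul_assoc]
    congr 1
    have hprod : ∏ t : Fin (n + 1), ((θ k.1).stateProb k.2 T t.castSucc *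
        (θ k.1).reward k.2 (T.state t.castSucc) (T.action t.castSucc) (T.rew t.castSucc)) =
        (θ k.1).envProb k.2 (H := n + 1) (Fin.init T) :=
      Finset.prod_congr rfl fun t _ => by rw [stateProb_castSucc]; rfl
    rw [hprod, ← h]
    simp only [pathLikelihood, Pi.mul_apply, stepKernel, if_pos hn]
    rw [← mul_assoc]
    rfl

/-- The difference of the two mixtures of contexts, as a linear form. -/
noncomputable def mixtureDiff (θ : Bool → LMDP S A R M) : (Bool × Fin M → ℝ) →ₗ[ℝ] ℝ :=
  ∑ k : Bool × Fin M, ((if k.1 then 1 else -1) * (θ k.1).weight k.2) • LinearMap.proj k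

theorem mixtureDiff_apply (θ : Bool → LMDP S A R M) (v : Bool × Fin M → ℝ) :
    mixtureDiff θ v = ∑ m, (θ true).weight m * v (true, m) -
      ∑ m, (θ false).weight m * v (false, m) := by
  simp [mixtureDiff, LinearMap.sum_apply, Fintype.sum_prod_type, sub_eq_add_neg]

variable [Fintype A]

theorem trajProb_eq (θ : LMDP S A R M) (π : Policy Ξ S A R H) (T : Trajectory S A R H) :
    θ.trajProb π T = (∫ ξ, ∏ t : Fin H, π.act ξ t (T.past t) (T.state t) (T.action t)
      ∂(π.seed : Measure Ξ)) * ∑ m, θ.weight m * θ.envProb m T := by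
  rw [trajProb, Finset.mul_sum]
  refine Finset.sum_congr rfl fun m _ => ?_
  rw [mul_left_comm, ← integral_mul_const]
  congr 2
  funext ξ
  rw [envProb, ← Finset.prod_mul_distrib]
  exact Finset.prod_congr rfl fun t _ => by ring

theorem pathSum_eq (θ : Bool → LMDP S A R M) (hH : 0 < H)
    (pol : (n : ℕ) → (Fin n → S × A × R) → S → A → ℝ) :
    pathSum (initKernel θ) (stepKernel θ H) pol H
      (fun _ v => 1 * (normSeminorm ℝ ℝ).comp (mixtureDiff θ) v) =
    ∑ T : Trajectory S A R H, actionProb pol T *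
      |mixtureDiff θ fun k => (θ k.1).envProb k.2 T| := by
  obtain ⟨n, rfl⟩ : ∃ n, H = n + 1 := ⟨H - 1, by omega⟩
  refine Finset.sum_congr rfl fun T _ => ?_
  rw [← Finset.mul_sum]
  congr 1
  rw [Finset.sum_eq_single (T (Fin.last n)).1]
  · beta_reduce
    rw [one_mul, Seminorm.comp_apply, coe_normSeminorm, Real.norm_eq_abs]
    congr 2
    funext k
    rw [← pathLikelihood_mul_reward θ k n n.lt_succ_self T]
    simp [pathLikelihood, stepKernel, Trajectory.state, Trajectory.action, Trajectory.rew]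
  · intro s _ hs
    have : pathLikelihood (initKernel θ) (stepKernel θ (n + 1)) (n + 1) T s = 0 := by
      funext k
      simp [pathLikelihood, stepKernel, hs]
    beta_reduce
    rw [this, map_zero, mul_zero]
  · simp

end LMDP

theorem Policy.integrable_prod_act {Ξ S A R : Type*} [MeasurableSpace Ξ] [Fintype A] {H : ℕ}
    (π : Policy Ξ S A R H) (T : Trajectory S A R H) :
    Integrable (fun ξ => ∏ t : Fin H, π.act ξ t (T.past t) (T.state t) (T.action t))
      (π.seed : Measure Ξ) := by
  refine Integrable.of_bound (C := 1)
    (Finset.measurable_prod _ fun t _ => π.measurable_act _ _ _ _).aestronglyMeasurable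
    (Filter.Eventually.of_forall fun ξ => ?_)
  rw [norm_prod]
  refine Finset.prod_le_one (fun _ _ => norm_nonneg _) fun t _ => ?_
  have h := mem_Icc_of_mem_stdSimplex (π.act ξ t (T.past t) (T.state t)).2 (T.action t)
  exact (Real.norm_of_nonneg h.1).trans_le h.2

namespace LMDP

variable {Ξ S A R : Type*} [MeasurableSpace Ξ] [Fintype S] [Fintype A] [Fintype R] {M H : ℕ}

theorem trajProb_sub (θ : Bool → LMDP S A R M) (π : Policy Ξ S A R H) (T : Trajectory S A R H) :
    (θ true).trajProb π T - (θ false).trajProb π T =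
      (∫ ξ, ∏ t : Fin H, π.act ξ t (T.past t) (T.state t) (T.action t) ∂(π.seed : Measure Ξ)) *
        mixtureDiff θ fun k => (θ k.1).envProb k.2 T := by
  rw [trajProb_eq, trajProb_eq, mixtureDiff_apply, mul_sub]

/-- It suffices to bound the difference of the two models for every value of the seed. -/
theorem sum_abs_trajProb_sub_le (θ : Bool → LMDP S A R M) (π : Policy Ξ S A R H) {C : ℝ}
    (hC : ∀ ξ, ∑ T : Trajectory S A R H,
      (∏ t : Fin H, π.act ξ t (T.past t) (T.state t) (T.action t)) *
        |mixtureDiff θ fun k => (θ k.1).envProb k.2 T| ≤ C) :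
    ∑ T, |(θ true).trajProb π T - (θ false).trajProb π T| ≤ C := by
  have hint : ∀ T : Trajectory S A R H, |(θ true).trajProb π T - (θ false).trajProb π T| =
      ∫ ξ, (∏ t : Fin H, π.act ξ t (T.past t) (T.state t) (T.action t)) *
        |mixtureDiff θ fun k => (θ k.1).envProb k.2 T| ∂(π.seed : Measure Ξ) := fun T => by
    rw [trajProb_sub, abs_mul, integral_mul_const, abs_of_nonneg]
    exact integral_nonneg fun ξ => Finset.prod_nonneg fun t _ => (π.act ξ t _ _).2.1 _
  have hi : ∀ T : Trajectory S A R H, Integrable (fun ξ =>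
      (∏ t : Fin H, π.act ξ t (T.past t) (T.state t) (T.action t)) *
        |mixtureDiff θ fun k => (θ k.1).envProb k.2 T|) (π.seed : Measure Ξ) :=
    fun T => (π.integrable_prod_act T).mul_const _
  simp only [hint]
  rw [← integral_finsetSum _ fun T _ => hi T]
  calc _ ≤ ∫ _, C ∂(π.seed : Measure Ξ) :=
        integral_mono (integrable_finsetSum _ fun T _ => hi T) (integrable_const C) hC
    _ = C := by simp

/-- The testing hypothesis in terms of deterministic memoryless policies. -/
theorem mlsValue_le_of_tvDist_le (θ : Bool → LMDP S A R M) (hH : 0 < H) {ε : ℝ}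
    (hε : ∀ ψ : MemorylessPolicy S A H,
      tvDist ((θ true).trajProb (ψ.toPolicy R)) ((θ false).trajProb (ψ.toPolicy R)) ≤ ε)
    (ψ : ℕ → S → A) :
    mlsValue (initKernel θ) (stepKernel θ H) ψ H
      (fun _ v => 1 * (normSeminorm ℝ ℝ).comp (mixtureDiff θ) v) ≤ 2 * ε := by
  classical
  have h := hε fun t s => stdSimplex.vertex (ψ t s)
  rw [← pathSum_deterministic, pathSum_eq θ hH]
  refine le_trans (le_of_eq ?_) (show 2 * tvDist _ _ ≤ 2 * ε by linarith)
  rw [tvDist, ← mul_assoc]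
  norm_num
  refine Finset.sum_congr rfl fun T _ => ?_
  rw [trajProb_sub, abs_mul]
  congr 1
  simp only [MemorylessPolicy.toPolicy, ProbabilityMeasure.coe_mk, integral_dirac]
  exact (abs_of_nonneg (Finset.prod_nonneg fun t _ => (stdSimplex.vertex (S := ℝ) (X := A) _).2.1 _)).symm

end LMDP

theorem lemma4 {Ξ S A R : Type*} [MeasurableSpace Ξ] [Fintype S] [Fintype A] [Fintype R]
    (M H : ℕ) (hH : 2 * M < H) (θ₁ θ₂ : LMDP S A R M) (ε : ℝ)
    (hε : ∀ ψ : MemorylessPolicy S A H,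
      tvDist (θ₁.trajProb (ψ.toPolicy R)) (θ₂.trajProb (ψ.toPolicy R)) ≤ ε)
    (π : Policy Ξ S A R H) :
    tvDist (θ₁.trajProb π) (θ₂.trajProb π) ≤
      (M : ℝ) * (2 * (H : ℝ) ^ 2) ^ (2 * M - 1) *
        ((M : ℝ) * (Fintype.card S : ℝ) * (Fintype.card A : ℝ)) ^ (2 * M - 1) * ε := by
  classical
  have hM : 1 ≤ M := by
    rcases Nat.eq_zero_or_pos M with rfl | h
    · simpa using θ₁.weight.2.2
    · exact h
  have hH0 : 0 < H := by omega
  rcases isEmpty_or_nonempty A with hA | hA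
  · have : IsEmpty (Trajectory S A R H) := ⟨fun T => hA.elim (T.action ⟨0, hH0⟩)⟩
    have hd : 2 * M - 1 ≠ 0 := by omega
    simp [tvDist, hd]
  have hS : Nonempty S := by
    by_contra hS
    rw [not_nonempty_iff] at hS
    simpa using (θ₁.init ⟨0, hM⟩).2.2
  let θ : Bool → LMDP S A R M := fun b => if b then θ₁ else θ₂
  have hmls := LMDP.mlsValue_le_of_tvDist_le θ hH0 hε
  have hopt := optValue_le_of_mlsValue_le (LMDP.stepKernel_nonneg θ H) H (2 * M) Finset.univ
    (by simp) _
    (fun v hv => by rw [show v = 0 from funext fun k => hv k (Finset.mem_univ k), map_zero])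
    H le_rfl (fun _ => 1) (fun _ => zero_le_one) (2 * ε) hmls
  have hε0 : 0 ≤ ε := by
    have := (mlsValue_nonneg H fun s v => mul_nonneg zero_le_one (apply_nonneg _ v)).trans
      (hmls fun _ _ => Classical.arbitrary A)
    linarith
  set x : ℝ := 2 * H * Fintype.card S * Fintype.card A with hx
  have htv : ∑ T, |θ₁.trajProb π T - θ₂.trajProb π T| ≤ geomBound x (2 * M) * (2 * ε) := by
    refine LMDP.sum_abs_trajProb_sub_le θ π fun ξ => ?_
    let pol : (n : ℕ) → (Fin n → S × A × R) → S → A → ℝ := fun n h s a =>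
      if hn : n < H then π.act ξ ⟨n, hn⟩ h s a else 0
    have hpol : ∀ T : Trajectory S A R H,
        ∏ t : Fin H, π.act ξ t (T.past t) (T.state t) (T.action t) = actionProb pol T := fun T =>
      Finset.prod_congr rfl fun t _ => by simp [pol]
    simp only [hpol]
    rw [← LMDP.pathSum_eq θ hH0]
    refine (pathSum_le_optValue (fun n h s a => ?_) (fun n h s => ?_) H
      fun s v => mul_nonneg zero_le_one (apply_nonneg _ v)).trans hopt
    · simp only [pol]
      split_ifs with hn
      · exact (π.act ξ ⟨n, hn⟩ h s).2.1 a
      · exact le_rfl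
    · by_cases hn : n < H
      · simp only [pol, dif_pos hn]
        exact (π.act ξ ⟨n, hn⟩ h s).2.2.le
      · simp [pol, hn]
  have hcS : (1 : ℝ) ≤ Fintype.card S := by exact_mod_cast Fintype.card_pos
  have hcA : (1 : ℝ) ≤ Fintype.card A := by exact_mod_cast Fintype.card_pos
  have hM1 : (1 : ℝ) ≤ M := by exact_mod_cast hM
  have hH3 : (3 : ℝ) ≤ H := by exact_mod_cast (by omega : 3 ≤ H)
  have hy1 : (1 : ℝ) ≤ Fintype.card S * Fintype.card A := one_le_mul_of_one_le_of_one_le hcS hcA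
  have hHy : 1 ≤ 2 * (H : ℝ) * (H - 1) * (Fintype.card S * Fintype.card A) :=
    one_le_mul_of_one_le_of_one_le (by nlinarith) hy1
  have hbase : 1 + x ≤ 2 * (H : ℝ) ^ 2 * (M * Fintype.card S * Fintype.card A) := by
    calc 1 + x = 1 + 2 * H * (Fintype.card S * Fintype.card A : ℝ) := by rw [hx]; ring
      _ ≤ 2 * (H : ℝ) ^ 2 * (1 * (Fintype.card S * Fintype.card A)) := by linarith
      _ ≤ 2 * (H : ℝ) ^ 2 * (M * (Fintype.card S * Fintype.card A)) := by gcongr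
      _ = _ := by ring
  have hgeom : geomBound x (2 * M) ≤
      (2 * (H : ℝ) ^ 2 * (M * Fintype.card S * Fintype.card A)) ^ (2 * M - 1) := by
    have h := geomBound_succ_le (x := x) (by positivity) (2 * M - 1)
    rw [show 2 * M - 1 + 1 = 2 * M by omega] at h
    exact h.trans (pow_le_pow_left₀ (by positivity) hbase _)
  calc tvDist (θ₁.trajProb π) (θ₂.trajProb π) ≤ geomBound x (2 * M) * ε := by
        rw [tvDist]; linarith
    _ ≤ 1 * (2 * (H : ℝ) ^ 2 * (M * Fintype.card S * Fintype.card A)) ^ (2 * M - 1) * ε := by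
        rw [one_mul]; gcongr
    _ ≤ M * (2 * (H : ℝ) ^ 2 * (M * Fintype.card S * Fintype.card A)) ^ (2 * M - 1) * ε := by
        gcongr
    _ = _ := by rw [mul_pow]; ring
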